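/- Let $\epsilon$ be a primitive cube root of unity and $K=\mathbb{Q}(\epsilon)$, with ring of integers $\mathbb{Z}[\epsilon]$. For $a,b\in K^*$ let $\left(\frac{a,b}{K,\epsilon}\right)$ denote the symbol algebra of degree $3$, that is, the $K$-algebra generated by $x,y$ subject to $x^3=a$, $y^3=b$, $yx=\epsilon xy$; it splits if it is isomorphic to a full matrix algebra over $K$. Let $p\neq 3$ be a rational prime, and let $\alpha\in K^*$ be such that, for every prime ideal $P$ of $\mathbb{Z}[\epsilon]$ dividing $p$, the exponent $\mathrm{ord}_P(\alpha)$ is either $0$ or a positive integer not divisible by $3$ (for example, $\alpha$ prime to $p$). Say that $\alpha$ is a cubic residue modulo $p$ if there is $x\in\mathbb{Z}[\epsilon]$ with $\alpha\equiv x^3 \pmod p$, the congruence being taken in the ring of elements of $K$ that are integral at all primes dividing $p$. Suppose that $L=K(\sqrt[3]{\alpha})$ has class number $h_L=1$. Then there exists a unit $u$ of $\mathbb{Z}[\epsilon]$ such that the symbol algebra $\left(\frac{\alpha,\,u\cdot p}{K,\epsilon}\right)$ splits if and only if $\alpha$ is a cubic residue modulo $p$. -/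

import Mathlib

/-- The defining relations `x ^ n = a`, `y ^ n = b`, `y x = ξ x y` of a symbol algebra, on the free
algebra on two generators `x = ι 0`, `y = ι 1`. -/
inductive SymbolAlgebra.Rel {F : Type*} [Field F] (n : ℕ) (a b ξ : F) :
    FreeAlgebra F (Fin 2) → FreeAlgebra F (Fin 2) → Prop
  | x_pow : SymbolAlgebra.Rel n a b ξ
      (FreeAlgebra.ι F 0 ^ n) (algebraMap F (FreeAlgebra F (Fin 2)) a)
  | y_pow : SymbolAlgebra.Rel n a b ξ
      (FreeAlgebra.ι F 1 ^ n) (algebraMap F (FreeAlgebra F (Fin 2)) b)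
  | y_mul_x : SymbolAlgebra.Rel n a b ξ
      (FreeAlgebra.ι F 1 * FreeAlgebra.ι F 0)
      (ξ • (FreeAlgebra.ι F 0 * FreeAlgebra.ι F 1))

/-- The symbol algebra `(a, b / F, ξ)` of degree `n`: the `F`-algebra generated by `x` and `y`
subject to `x ^ n = a`, `y ^ n = b`, `y x = ξ x y`. -/
abbrev SymbolAlgebra {F : Type*} [Field F] (n : ℕ) (a b ξ : F) : Type _ :=
  RingQuot (SymbolAlgebra.Rel n a b ξ)

/-- An `F`-algebra is split if it is isomorphic to a full matrix algebra over `F`. -/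
def IsSplitAlgebra (F A : Type*) [Field F] [Ring A] [Algebra F A] : Prop :=
  ∃ m : ℕ, 0 < m ∧ Nonempty (A ≃ₐ[F] Matrix (Fin m) (Fin m) F)

open NumberField IsDedekindDomain in
/-- `α ∈ K` is a cubic residue modulo the rational prime `p`: there is an integer `x` of `K` with
`α ≡ x ^ 3 (mod p)`. As `α` need not be integral, the congruence is taken in the ring of
`p`-integral elements of `K`: `ord_P (α - x ^ 3) ≥ ord_P p` for all primes `P` dividing `p`. -/
def IsCubicResidueMod {K : Type*} [Field K] [NumberField K] (α : K) (p : ℕ) : Prop :=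
  ∃ x : 𝓞 K, ∀ P : HeightOneSpectrum (𝓞 K), (p : 𝓞 K) ∈ P.asIdeal →
    P.valuation K (α - (x : K) ^ 3) ≤ P.valuation K (p : K)

open NumberField IsDedekindDomain in
/-- At each prime `P` dividing `p`, the exponent `ord_P α` is nonnegative, and it is a multiple
of `3` only if it is `0`. Every `α` prime to `p` has this property. -/
def HasNoCubeAt {K : Type*} [Field K] [NumberField K] (α : K) (p : ℕ) : Prop :=
  ∀ P : HeightOneSpectrum (𝓞 K), (p : 𝓞 K) ∈ P.asIdeal →
    P.valuation K α ≤ 1 ∧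
      ((∃ y : K, P.valuation K α = P.valuation K y ^ 3) → P.valuation K α = 1)

/-! If `α` is not a cube, the symbol algebra splits exactly when `β = u p` is a value of
`cubicNormForm α`, that is, a norm from `L = K(∛α)` (`isSplitAlgebra_of_cubicNormForm`,
`exists_cubicNormForm_of_isSplitAlgebra`). If `α` is a cube, both sides of the equivalence hold.

Splitting implies residue: `p` is unramified in `K`, so `u p` has order 1 at each `P ∣ p`. If `α`
were not a cube modulo `P`, the norm form would be anisotropic over the residue field, and all its
values would have order divisible by 3. So `α` is a cube modulo every `P ∣ p`, and the Chinese
remainder theorem glues the roots.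

Residue implies splitting: at each `P ∣ p` some norm has order prime to 3, namely that of `θ` or of
some `θ - y`. As `𝓞 L` is principal, a prime element of `𝓞 L` then has norm a unit times `π ^ k`
with `P = (π)` and `3 ∤ k`. Since `π ^ 3` is itself a norm, `π` is a norm up to a unit. Multiplying
over the prime factors of `p` makes `p` a norm up to a unit, which supplies `u`. -/

/-! ### The cubic norm form and its anisotropy. -/

/-- The norm form of `R[X] / (X ^ 3 - α)` in the basis `1, X, X ^ 2`. -/
def cubicNormForm {R : Type*} [CommRing R] (α a b c : R) : R :=
  a ^ 3 + α * b ^ 3 + α ^ 2 * c ^ 3 - 3 * α * a * b * c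

theorem cubicNormForm_eq_zero {F : Type*} [Field F] {α : F} (hα : ∀ z : F, z ^ 3 ≠ α)
    {a b c : F} (h : cubicNormForm α a b c = 0) : a = 0 ∧ b = 0 ∧ c = 0 := by
  unfold cubicNormForm at h
  have linear (r s : F) (hrs : r ^ 3 + α * s ^ 3 = 0) : r = 0 ∧ s = 0 := by
    have hs : s = 0 := by
      by_contra hs
      refine hα (-r / s) ?_
      field_simp
      linear_combination -hrs
    subst hs
    simpa using hrs
  -- Multiplying `a + b X + c X ^ 2` by `c X - b`, whose norm is `α c ^ 3 - b ^ 3`, gives a linear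
  -- element modulo `X ^ 3 - α`; norms multiply.
  have h1 := linear (c ^ 2 * α - a * b) (a * c - b ^ 2) (by linear_combination (α * c ^ 3 - b ^ 3) * h)
  have hc : c = 0 := by
    by_contra hc
    refine hα (b / c) ?_
    field_simp
    linear_combination -c * h1.1 - b * h1.2
  subst hc
  obtain ⟨ha, hb⟩ := linear a b (by linear_combination h)
  exact ⟨ha, hb, rfl⟩

theorem IsPrimitiveRoot.sq_add_self_add_one {F : Type*} [Field F] {ε : F}
    (hε : IsPrimitiveRoot ε 3) : ε ^ 2 + ε + 1 = 0 := by
  have h := hε.geom_sum_eq_zero (by norm_num)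
  simp only [Finset.sum_range_succ, Finset.range_zero, Finset.sum_empty] at h
  linear_combination h

theorem linearIndependent_of_cubic {F V : Type*} [Field F] [AddCommGroup V] [Module F V] {α : F}
    (hα : ∀ z : F, z ^ 3 ≠ α) {T : V →ₗ[F] V} (hT : ∀ v, T (T (T v)) = α • v) {v : V}
    (hv : v ≠ 0) : LinearIndependent F ![v, T v, T (T v)] := by
  rw [Fintype.linearIndependent_iff]
  intro g hg
  simp only [Fin.sum_univ_three, Matrix.cons_val_zero, Matrix.cons_val_one,
    Matrix.cons_val] at hg
  have hg1 := congrArg T hg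
  have hg2 := congrArg T hg1
  simp only [map_add, map_smul, map_zero, hT] at hg1 hg2
  -- The multipliers are the coefficients of the cofactor `f(εX) f(ε²X)` of `f = g 0 + g 1 X + g 2 X
  -- ^ 2`, which do not involve `ε`.
  have h0 : cubicNormForm α (g 0) (g 1) (g 2) • v = 0 := by
    unfold cubicNormForm
    linear_combination (norm := module) (g 0 ^ 2 - α * g 1 * g 2) • hg +
      (α * g 2 ^ 2 - g 0 * g 1) • hg1 + (g 1 ^ 2 - g 0 * g 2) • hg2
  obtain ⟨h0, h1, h2⟩ := cubicNormForm_eq_zero hα ((smul_eq_zero.1 h0).resolve_right hv)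
  intro i
  fin_cases i <;> assumption

/-! ### Cubic symbol algebras and their splitting criterion. -/

namespace SymbolAlgebra

variable {F : Type*} [Field F] {α β ε : F}

/-- The first generator of a cubic symbol algebra. -/
def x (α β ε : F) : SymbolAlgebra 3 α β ε := RingQuot.mkAlgHom F _ (FreeAlgebra.ι F 0)

/-- The second generator of a cubic symbol algebra. -/
def y (α β ε : F) : SymbolAlgebra 3 α β ε := RingQuot.mkAlgHom F _ (FreeAlgebra.ι F 1)

theorem x_pow_three : x α β ε ^ 3 = algebraMap F _ α := by
  rw [x, ← map_pow, RingQuot.mkAlgHom_rel F Rel.x_pow, AlgHom.commutes]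

theorem y_pow_three : y α β ε ^ 3 = algebraMap F _ β := by
  rw [y, ← map_pow, RingQuot.mkAlgHom_rel F Rel.y_pow, AlgHom.commutes]

theorem y_mul_x : y α β ε * x α β ε = ε • (x α β ε * y α β ε) := by
  rw [x, y, ← map_mul, RingQuot.mkAlgHom_rel F Rel.y_mul_x, map_smul, map_mul]

theorem y_mul_x_pow (i : ℕ) : y α β ε * x α β ε ^ i = ε ^ i • (x α β ε ^ i * y α β ε) := by
  induction i with
  | zero => simp
  | succ i ih =>
    rw [pow_succ, ← mul_assoc, ih, smul_mul_assoc, mul_assoc, y_mul_x, mul_smul_comm, smul_smul,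
      mul_assoc, pow_succ]

/-- The homomorphism out of a cubic symbol algebra given by the images of the generators. -/
def lift {A : Type*} [Ring A] [Algebra F A] (X Y : A) (hX : X ^ 3 = algebraMap F A α)
    (hY : Y ^ 3 = algebraMap F A β) (hYX : Y * X = ε • (X * Y)) :
    SymbolAlgebra 3 α β ε →ₐ[F] A :=
  RingQuot.liftAlgHom F ⟨FreeAlgebra.lift F ![X, Y], by
    rintro _ _ (_ | _ | _) <;> simp [hX, hY, hYX]⟩

theorem lift_x {A : Type*} [Ring A] [Algebra F A] (X Y : A) (hX : X ^ 3 = algebraMap F A α)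
    (hY : Y ^ 3 = algebraMap F A β) (hYX : Y * X = ε • (X * Y)) :
    lift X Y hX hY hYX (x α β ε) = X := by
  simp [lift, x]

theorem lift_y {A : Type*} [Ring A] [Algebra F A] (X Y : A) (hX : X ^ 3 = algebraMap F A α)
    (hY : Y ^ 3 = algebraMap F A β) (hYX : Y * X = ε • (X * Y)) :
    lift X Y hX hY hYX (y α β ε) = Y := by
  simp [lift, y]

variable (α β ε) in
/-- The nine monomials `x ^ i * y ^ j` with `i, j < 3`. -/
def monomial (ij : Fin 3 × Fin 3) : SymbolAlgebra 3 α β ε :=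
  x α β ε ^ (ij.1 : ℕ) * y α β ε ^ (ij.2 : ℕ)

theorem x_pow_mul_y_pow_mem_span (i j : ℕ) :
    x α β ε ^ i * y α β ε ^ j ∈ Submodule.span F (Set.range (monomial α β ε)) := by
  have hi : x α β ε ^ i = α ^ (i / 3) • x α β ε ^ (i % 3) := by
    conv_lhs => rw [← Nat.div_add_mod i 3, pow_add, pow_mul, x_pow_three, ← map_pow,
      ← Algebra.smul_def]
  have hj : y α β ε ^ j = β ^ (j / 3) • y α β ε ^ (j % 3) := by
    conv_lhs => rw [← Nat.div_add_mod j 3, pow_add, pow_mul, y_pow_three, ← map_pow,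
      ← Algebra.smul_def]
  rw [hi, hj, smul_mul_smul_comm]
  exact Submodule.smul_mem _ _ (Submodule.subset_span
    ⟨(⟨i % 3, Nat.mod_lt _ (by norm_num)⟩, ⟨j % 3, Nat.mod_lt _ (by norm_num)⟩), rfl⟩)

/-- The span of the monomials contains 1 and is stable under left multiplication by both generators,
so it is a left ideal containing 1. -/
theorem span_monomial : Submodule.span F (Set.range (monomial α β ε)) = ⊤ := by
  set S := Submodule.span F (Set.range (monomial α β ε)) with hS
  have hx : ∀ s ∈ S, x α β ε * s ∈ S := by
    intro s hs
    induction hs using Submodule.span_induction with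
    | mem s hs =>
      obtain ⟨⟨i, j⟩, rfl⟩ := hs
      rw [monomial, ← mul_assoc, ← pow_succ']
      exact x_pow_mul_y_pow_mem_span _ _
    | zero => simp
    | add s t _ _ hs ht => rw [mul_add]; exact S.add_mem hs ht
    | smul r s _ hs => rw [mul_smul_comm]; exact S.smul_mem r hs
  have hy : ∀ s ∈ S, y α β ε * s ∈ S := by
    intro s hs
    induction hs using Submodule.span_induction with
    | mem s hs =>
      obtain ⟨⟨i, j⟩, rfl⟩ := hs
      rw [monomial, ← mul_assoc, y_mul_x_pow, smul_mul_assoc, mul_assoc, ← pow_succ']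
      exact S.smul_mem _ (x_pow_mul_y_pow_mem_span _ _)
    | zero => simp
    | add s t _ _ hs ht => rw [mul_add]; exact S.add_mem hs ht
    | smul r s _ hs => rw [mul_smul_comm]; exact S.smul_mem r hs
  have key (f : FreeAlgebra F (Fin 2)) :
      ∀ s ∈ S, RingQuot.mkAlgHom F (Rel 3 α β ε) f * s ∈ S := by
    induction f using FreeAlgebra.induction with
    | grade0 r =>
      intro s hs
      rw [AlgHom.commutes, ← Algebra.smul_def]
      exact S.smul_mem r hs
    | grade1 i =>
      fin_cases i
      · exact hx
      · exact hy
    | mul f g hf hg =>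
      intro s hs
      rw [map_mul, mul_assoc]
      exact hf _ (hg _ hs)
    | add f g hf hg =>
      intro s hs
      rw [map_add, add_mul]
      exact S.add_mem (hf _ hs) (hg _ hs)
  rw [eq_top_iff]
  intro z _
  obtain ⟨f, rfl⟩ := RingQuot.mkAlgHom_surjective F (Rel 3 α β ε) z
  have h1 : (1 : SymbolAlgebra 3 α β ε) ∈ S := by
    simpa using x_pow_mul_y_pow_mem_span (α := α) (β := β) (ε := ε) 0 0
  simpa using key f 1 h1

instance : Module.Finite F (SymbolAlgebra 3 α β ε) :=
  ⟨⟨(Set.finite_range (monomial α β ε)).toFinset, by simpa using span_monomial⟩⟩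

theorem finrank_le : Module.finrank F (SymbolAlgebra 3 α β ε) ≤ 9 := by
  have h := finrank_range_le_card (R := F) (monomial α β ε)
  rw [Set.finrank, span_monomial, finrank_top] at h
  simpa using h

/-- The matrix of multiplication by `X` on `F[X] / (X ^ 3 - α)`. -/
def companion (α : F) : Matrix (Fin 3) (Fin 3) F := !![0, 0, α; 1, 0, 0; 0, 1, 0]

/-- The matrix of multiplication by `a + b X + c X ^ 2` on `F[X] / (X ^ 3 - α)`. -/
def mulMatrix (α a b c : F) : Matrix (Fin 3) (Fin 3) F :=
  !![a, α * c, α * b; b, a, α * c; c, b, a]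

/-- The matrix of the automorphism `X ↦ ε X` of `F[X] / (X ^ 3 - α)`. -/
def twist (ε : F) : Matrix (Fin 3) (Fin 3) F := !![1, 0, 0; 0, ε, 0; 0, 0, ε ^ 2]

theorem companion_pow_three : companion α ^ 3 = algebraMap F _ α := by
  ext i j
  fin_cases i <;> fin_cases j <;>
    simp [companion, pow_succ, Matrix.mul_apply, Fin.sum_univ_three, Matrix.algebraMap_matrix_apply]

theorem mulMatrix_mul (a b c a' b' c' : F) :
    mulMatrix α a b c * mulMatrix α a' b' c' = mulMatrix α (a * a' + α * (b * c' + c * b'))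
      (a * b' + b * a' + α * (c * c')) (a * c' + b * b' + c * a') := by
  ext i j
  fin_cases i <;> fin_cases j <;>
    simp [mulMatrix, Matrix.mul_apply, Fin.sum_univ_three] <;> ring

theorem mulMatrix_eq (a b c : F) :
    mulMatrix α a b c = a • 1 + b • companion α + c • companion α ^ 2 := by
  ext i j
  fin_cases i <;> fin_cases j <;>
    simp [mulMatrix, companion, sq] <;> ring

theorem twist_mul_mulMatrix (h : ε ^ 3 = 1) (a b c : F) :
    twist ε * mulMatrix α a b c = mulMatrix α a (ε * b) (ε ^ 2 * c) * twist ε := by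
  ext i j
  fin_cases i <;> fin_cases j <;>
    simp [mulMatrix, twist, Matrix.mul_apply, Fin.sum_univ_three] <;> grind

theorem twist_pow_three (h : ε ^ 3 = 1) : twist ε ^ 3 = 1 := by
  ext i j
  fin_cases i <;> fin_cases j <;>
    simp [twist, pow_succ, Matrix.mul_apply, Fin.sum_univ_three] <;> grind

theorem mulMatrix_conj (h : ε ^ 2 + ε + 1 = 0) (a b c : F) :
    mulMatrix α a b c * (mulMatrix α a (ε * b) (ε ^ 2 * c) *
      mulMatrix α a (ε * (ε * b)) (ε ^ 2 * (ε ^ 2 * c))) =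
      algebraMap F _ (cubicNormForm α a b c) := by
  rw [mulMatrix_mul, mulMatrix_mul]
  ext i j
  fin_cases i <;> fin_cases j <;>
    simp [mulMatrix, Matrix.algebraMap_matrix_apply, cubicNormForm] <;> grind

theorem matrix_eq (h : ε ^ 2 + ε + 1 = 0) (h3 : (3 : F) ≠ 0) (hα : α ≠ 0)
    (M : Matrix (Fin 3) (Fin 3) F) :
    ∃ r s t : Fin 3 → F, M = ∑ k : Fin 3,
      (r k • 1 + s k • twist ε + t k • twist ε ^ 2) * companion α ^ (k : ℕ) := by
  have diag (d : Fin 3 → F) : ∃ r s t : F,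
      Matrix.diagonal d = r • 1 + s • twist ε + t • twist ε ^ 2 := by
    -- Fourier inversion over the characters of the group of cube roots of unity.
    refine ⟨(d 0 + d 1 + d 2) / 3, (d 0 + ε ^ 2 * d 1 + ε * d 2) / 3,
      (d 0 + ε * d 1 + ε ^ 2 * d 2) / 3, ?_⟩
    ext i j
    fin_cases i <;> fin_cases j <;>
      simp [twist, sq] <;> grind
  choose r s t hd using diag
  -- `d k` lists the entries of `M` on the `k`-th cyclic diagonal, the support of `companion α ^ k`,
  -- divided by `α` where that power has entry `α`.
  let d : Fin 3 → Fin 3 → F :=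
    ![![M 0 0, M 1 1, M 2 2], ![M 0 2 / α, M 1 0, M 2 1], ![M 0 1 / α, M 1 2 / α, M 2 0]]
  refine ⟨fun k => r (d k), fun k => s (d k), fun k => t (d k), ?_⟩
  simp_rw [← hd]
  ext i j
  fin_cases i <;> fin_cases j <;>
    simp [d, Fin.sum_univ_three, companion, sq, Matrix.mul_apply, Matrix.diagonal, hα]

/-- The algebra acts on `F[X] / (X ^ 3 - α)`: `x` multiplies by `X`, and `y` is the twist `X ↦ ε X`
followed by multiplication by `g = a + b X + c X ^ 2`. The cube of the latter is the norm of `g`,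
that is, `β`. This representation is onto the 3 by 3 matrices, and the bound 9 on the dimension
makes it injective. -/
theorem isSplitAlgebra_of_cubicNormForm (hε : IsPrimitiveRoot ε 3) (hα : α ≠ 0) (hβ : β ≠ 0)
    {a b c : F} (hN : cubicNormForm α a b c = β) :
    IsSplitAlgebra F (SymbolAlgebra 3 α β ε) := by
  have h := hε.sq_add_self_add_one
  have h1 : ε ^ 3 = 1 := hε.pow_eq_one
  have h3 : (3 : F) ≠ 0 := by
    intro h3
    have : (ε - 1) ^ 2 = 0 := by linear_combination h - ε * h3
    exact hε.ne_one (by norm_num) (sub_eq_zero.1 (pow_eq_zero_iff (two_ne_zero) |>.1 this))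
  set G := mulMatrix α a b c with hG
  set D := twist ε with hD
  set X := companion α with hX
  have hconj := mulMatrix_conj (α := α) h a b c
  rw [hN] at hconj
  have hXG : X = mulMatrix α 0 1 0 := by simp [mulMatrix_eq, hX]
  have hDX : D * X = ε • (X * D) := by
    rw [hXG, hD, twist_mul_mulMatrix h1, ← smul_mul_assoc]
    simp [mulMatrix_eq]
  have hGX : Commute G X := by
    rw [commute_iff_eq, hXG, hG, mulMatrix_mul, mulMatrix_mul]
    simp
  have hY : (G * D) ^ 3 = algebraMap F _ β := by
    calc (G * D) ^ 3 = G * (D * G) * (D * G) * D := by noncomm_ring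
      _ = G * mulMatrix α a (ε * b) (ε ^ 2 * c) * (D * mulMatrix α a (ε * b) (ε ^ 2 * c)) * D * D := by
        rw [hG, twist_mul_mulMatrix h1]; noncomm_ring
      _ = G * (mulMatrix α a (ε * b) (ε ^ 2 * c) *
            mulMatrix α a (ε * (ε * b)) (ε ^ 2 * (ε ^ 2 * c))) * D ^ 3 := by
        rw [twist_mul_mulMatrix h1]; noncomm_ring
      _ = _ := by rw [hconj, twist_pow_three h1, mul_one]
  let φ := lift (β := β) X (G * D) companion_pow_three hY (by
    rw [mul_assoc, hDX, mul_smul_comm, ← mul_assoc, hGX.eq, mul_assoc])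
  have hXmem : X ∈ φ.range := ⟨x α β ε, lift_x _ _ _ _ _⟩
  have hYmem : G * D ∈ φ.range := ⟨y α β ε, lift_y _ _ _ _ _⟩
  have hmem (a b c : F) : mulMatrix α a b c ∈ φ.range := by
    rw [mulMatrix_eq]
    exact add_mem (add_mem (φ.range.smul_mem (one_mem _) _) (φ.range.smul_mem hXmem _))
      (φ.range.smul_mem (pow_mem hXmem 2) _)
  have hDmem : D ∈ φ.range := by
    have hcomm : G * (mulMatrix α a (ε * b) (ε ^ 2 * c) *
        mulMatrix α a (ε * (ε * b)) (ε ^ 2 * (ε ^ 2 * c))) =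
        (mulMatrix α a (ε * b) (ε ^ 2 * c) *
        mulMatrix α a (ε * (ε * b)) (ε ^ 2 * (ε ^ 2 * c))) * G := by
      simp only [hG, mulMatrix_mul]
      congr 1 <;> ring
    -- The product of the other two conjugates of `G`, divided by `β`, is the inverse of `G`; it
    -- isolates the twist from `G * D`.
    have hD' : D = β⁻¹ • ((mulMatrix α a (ε * b) (ε ^ 2 * c) *
        mulMatrix α a (ε * (ε * b)) (ε ^ 2 * (ε ^ 2 * c))) * (G * D)) := by
      rw [← mul_assoc, ← hcomm, hconj, ← Algebra.smul_def, smul_smul, inv_mul_cancel₀ hβ, one_smul]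
    rw [hD']
    exact φ.range.smul_mem (mul_mem (mul_mem (hmem _ _ _) (hmem _ _ _)) hYmem) _
  have hsurj : Function.Surjective φ := by
    intro M
    obtain ⟨r, s, t, hM⟩ := matrix_eq h h3 hα M
    change M ∈ φ.range
    rw [hM]
    exact sum_mem fun k _ => mul_mem (add_mem (add_mem (φ.range.smul_mem (one_mem _) _)
      (φ.range.smul_mem hDmem _)) (φ.range.smul_mem (pow_mem hDmem 2) _)) (pow_mem hXmem _)
  have hrank : Module.finrank F (SymbolAlgebra 3 α β ε) =
      Module.finrank F (Matrix (Fin 3) (Fin 3) F) := by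
    refine le_antisymm (finrank_le.trans (by simp [Module.finrank_matrix]))
      (LinearMap.finrank_le_finrank_of_surjective (f := φ.toLinearMap) hsurj)
  have hinj : Function.Injective φ :=
    (LinearMap.injective_iff_surjective_of_finrank_eq_finrank (f := φ.toLinearMap) hrank).2 hsurj
  exact ⟨3, by norm_num, ⟨AlgEquiv.ofBijective φ ⟨hinj, hsurj⟩⟩⟩

/-- `V` is a line over `F(∛α)`, with `T` acting as `∛α`, so `S v = g(T) v` for some `g`. As `S` is
semilinear for `T ↦ ε T`, `S ^ 3` multiplies `v` by the product of the conjugates of `g`, which is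
its norm. -/
theorem exists_cubicNormForm_of_linearMap {V : Type*} [AddCommGroup V] [Module F V]
    [FiniteDimensional F V] (h : ε ^ 2 + ε + 1 = 0) (hα : ∀ z : F, z ^ 3 ≠ α)
    (hV : Module.finrank F V ≤ 3) {T S : V →ₗ[F] V} (hT : ∀ v, T (T (T v)) = α • v)
    (hS : ∀ v, S (S (S v)) = β • v) (hST : ∀ v, S (T v) = ε • T (S v)) {v : V} (hv : v ≠ 0) :
    ∃ a b c : F, cubicNormForm α a b c = β := by
  have hli := linearIndependent_of_cubic hα hT hv
  have hcard : Fintype.card (Fin 3) = Module.finrank F V :=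
    le_antisymm hli.fintype_card_le_finrank (by simpa using hV)
  have hspan := hli.span_eq_top_of_card_eq_finrank' hcard
  have hmem : S v ∈ Submodule.span F (Set.range ![v, T v, T (T v)]) := hspan ▸ Submodule.mem_top
  obtain ⟨g, hg⟩ := (Submodule.mem_span_range_iff_exists_fun F).1 hmem
  simp only [Fin.sum_univ_three, Matrix.cons_val_zero, Matrix.cons_val_one,
    Matrix.cons_val] at hg
  refine ⟨g 0, g 1, g 2, smul_left_injective F hv ?_⟩
  have h1 := hS v
  simp only [← hg, map_add, map_smul, hST, hT, smul_add, smul_smul] at h1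
  dsimp only
  rw [← h1]
  unfold cubicNormForm
  match_scalars <;> grind

theorem exists_cubicNormForm_of_isSplitAlgebra (hε : IsPrimitiveRoot ε 3)
    (hα : ∀ z : F, z ^ 3 ≠ α) (h : IsSplitAlgebra F (SymbolAlgebra 3 α β ε)) :
    ∃ a b c : F, cubicNormForm α a b c = β := by
  obtain ⟨m, hm, ⟨e⟩⟩ := h
  have hm3 : m ≤ 3 := by
    have h9 := finrank_le (α := α) (β := β) (ε := ε)
    rw [e.toLinearEquiv.finrank_eq, Module.finrank_matrix] at h9
    simp at h9
    nlinarith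
  let f := e.trans Matrix.toLinAlgEquiv'
  have hT := congrArg f (x_pow_three (α := α) (β := β) (ε := ε))
  have hS := congrArg f (y_pow_three (α := α) (β := β) (ε := ε))
  have hST := congrArg f (y_mul_x (α := α) (β := β) (ε := ε))
  rw [map_pow, AlgEquiv.commutes] at hT hS
  rw [map_smul, map_mul, map_mul] at hST
  have : Nonempty (Fin m) := ⟨⟨0, hm⟩⟩
  obtain ⟨v, hv⟩ := exists_ne (0 : Fin m → F)
  refine exists_cubicNormForm_of_linearMap (V := Fin m → F) hε.sq_add_self_add_one hα
    (by simpa using hm3) (T := f (x α β ε)) (S := f (y α β ε)) (fun v => ?_) (fun v => ?_)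
    (fun v => ?_) hv
  · simpa [pow_succ, Algebra.algebraMap_eq_smul_one] using LinearMap.congr_fun hT v
  · simpa [pow_succ, Algebra.algebraMap_eq_smul_one] using LinearMap.congr_fun hS v
  · simpa using LinearMap.congr_fun hST v

theorem isSplitAlgebra_of_pow_three (hε : IsPrimitiveRoot ε 3) {z : F} (hz : z ^ 3 = α)
    (hα : α ≠ 0) (hβ : β ≠ 0) : IsSplitAlgebra F (SymbolAlgebra 3 α β ε) := by
  have h3 : (3 : F) ≠ 0 := by
    intro h3
    have : (ε - 1) ^ 2 = 0 := by linear_combination hε.sq_add_self_add_one - ε * h3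
    exact hε.ne_one (by norm_num) (sub_eq_zero.1 (pow_eq_zero_iff (two_ne_zero) |>.1 this))
  have hz0 : z ≠ 0 := by rintro rfl; exact hα (by simp [← hz])
  -- Here `X ^ 3 - α` has the roots `z, ε z, ε² z`; Lagrange interpolation of the values `β, 1, 1`
  -- gives an element of norm `β`.
  refine isSplitAlgebra_of_cubicNormForm hε hα hβ (a := (β + 2) / 3) (b := (β - 1) / (3 * z))
    (c := (β - 1) / (3 * z ^ 2)) ?_
  unfold cubicNormForm
  rw [← hz]
  field_simp
  ring

end SymbolAlgebra

/-! ### Norms from a pure cubic extension. -/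

section PureCubic

variable {K L : Type*} [Field K] [Field L] [Algebra K L] {α : K} {θ : L}

theorem finrank_of_pow_three (hα : ∀ z : K, z ^ 3 ≠ α) (hθ : θ ^ 3 = algebraMap K L α)
    (hL : IntermediateField.adjoin K {θ} = ⊤) : Module.finrank K L = 3 := by
  have hroot : Polynomial.aeval θ (Polynomial.X ^ 3 - Polynomial.C α) = 0 := by simp [hθ]
  have hmonic : (Polynomial.X ^ 3 - Polynomial.C α).Monic :=
    Polynomial.monic_X_pow_sub_C α (by norm_num)
  have hirr := (X_pow_sub_C_irreducible_iff_of_prime Nat.prime_three).2 hα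
  rw [← IntermediateField.finrank_top', ← hL,
    IntermediateField.adjoin.finrank ⟨_, hmonic, hroot⟩,
    ← minpoly.eq_of_irreducible_of_monic hirr hroot hmonic, Polynomial.natDegree_X_pow_sub_C]

theorem norm_of_pow_three [FiniteDimensional K L] (hα : ∀ z : K, z ^ 3 ≠ α)
    (hθ : θ ^ 3 = algebraMap K L α) (hL : IntermediateField.adjoin K {θ} = ⊤) (a b c : K) :
    Algebra.norm K (a • 1 + b • θ + c • θ ^ 2) = cubicNormForm α a b c := by
  have hli := linearIndependent_of_cubic (T := LinearMap.mulLeft K θ) (v := (1 : L)) hα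
    (fun v => by simp [Algebra.smul_def, ← hθ, pow_succ, mul_assoc]) one_ne_zero
  let B := basisOfLinearIndependentOfCardEqFinrank hli (by simp [finrank_of_pow_three hα hθ hL])
  have h0 : B 0 = 1 := by simp [B]
  have h1 : B 1 = θ := by simp [B]
  have h2 : B 2 = θ * θ := by simp [B]
  have e0 : θ * B 0 = B 1 := by rw [h0, h1, mul_one]
  have e1 : θ * B 1 = B 2 := by rw [h1, h2]
  have e2 : θ * B 2 = α • B 0 := by
    rw [h2, h0, Algebra.smul_def, ← hθ, mul_one, pow_succ, sq, mul_assoc]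
  have hM : Algebra.leftMulMatrix B θ = SymbolAlgebra.companion α := by
    ext i j
    rw [Algebra.leftMulMatrix_eq_repr_mul]
    fin_cases j
    · fin_cases i <;> simp [e0, SymbolAlgebra.companion]
    · fin_cases i <;> simp [e1, SymbolAlgebra.companion]
    · fin_cases i <;> simp [e2, SymbolAlgebra.companion]
  rw [Algebra.norm_eq_matrix_det B, map_add, map_add, map_smul, map_smul, map_smul, map_pow,
    map_one, hM, ← SymbolAlgebra.mulMatrix_eq, Matrix.det_fin_three]
  simp [SymbolAlgebra.mulMatrix, cubicNormForm]
  ring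

theorem exists_norm_eq_cubicNormForm [FiniteDimensional K L] (hα : ∀ z : K, z ^ 3 ≠ α)
    (hθ : θ ^ 3 = algebraMap K L α) (hL : IntermediateField.adjoin K {θ} = ⊤) (z : L) :
    ∃ a b c : K, Algebra.norm K z = cubicNormForm α a b c := by
  have hli := linearIndependent_of_cubic (T := LinearMap.mulLeft K θ) (v := (1 : L)) hα
    (fun v => by simp [Algebra.smul_def, ← hθ, pow_succ, mul_assoc]) one_ne_zero
  have hspan := hli.span_eq_top_of_card_eq_finrank' (by simp [finrank_of_pow_three hα hθ hL])
  have hz : z ∈ Submodule.span K (Set.range ![1, LinearMap.mulLeft K θ 1,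
    LinearMap.mulLeft K θ (LinearMap.mulLeft K θ 1)]) := hspan ▸ Submodule.mem_top
  obtain ⟨g, hg⟩ := (Submodule.mem_span_range_iff_exists_fun K).1 hz
  refine ⟨g 0, g 1, g 2, ?_⟩
  rw [← norm_of_pow_three hα hθ hL, ← hg]
  simp [Fin.sum_univ_three, sq]

end PureCubic

/-! ### Valuations modulo cubes and local cubic residues. -/

section Valuation

open NumberField IsDedekindDomain

variable {K : Type*} [Field K] [NumberField K]

/-- The `P`-adic valuation of `z` is that of a cube. -/
def IsCubeVal (P : HeightOneSpectrum (𝓞 K)) (z : K) : Prop :=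
  ∃ y : K, P.valuation K z = P.valuation K y ^ 3

theorem IsCubeVal.mul {P : HeightOneSpectrum (𝓞 K)} {z w : K} (hz : IsCubeVal P z)
    (hw : IsCubeVal P w) : IsCubeVal P (z * w) := by
  obtain ⟨y, hy⟩ := hz
  obtain ⟨x, hx⟩ := hw
  exact ⟨y * x, by rw [map_mul, map_mul, hy, hx, mul_pow]⟩

theorem IsCubeVal.div {P : HeightOneSpectrum (𝓞 K)} {z w : K} (hz : IsCubeVal P z)
    (hw : IsCubeVal P w) : IsCubeVal P (z / w) := by
  obtain ⟨y, hy⟩ := hz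
  obtain ⟨x, hx⟩ := hw
  exact ⟨y / x, by rw [map_div₀, map_div₀, hy, hx, div_pow]⟩

theorem isCubeVal_of_eq_one {P : HeightOneSpectrum (𝓞 K)} {z : K} (hz : P.valuation K z = 1) :
    IsCubeVal P z := ⟨1, by simp [hz]⟩

theorem isCubeVal_pow_three (P : HeightOneSpectrum (𝓞 K)) (z : K) : IsCubeVal P (z ^ 3) :=
  ⟨z, map_pow _ _ _⟩

theorem valuation_unit (P : HeightOneSpectrum (𝓞 K)) (u : (𝓞 K)ˣ) :
    P.valuation K ((u : 𝓞 K) : K) = 1 := by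
  rw [HeightOneSpectrum.valuation_eq_one_iff_notMem]
  exact fun h => P.isPrime.ne_top (Ideal.eq_top_of_isUnit_mem _ h u.isUnit)

theorem not_isCubeVal_of_eq_exp {P : HeightOneSpectrum (𝓞 K)} {z : K}
    (hz : P.valuation K z = WithZero.exp (-1 : ℤ)) : ¬ IsCubeVal P z := by
  rintro ⟨y, hy⟩
  rw [hz] at hy
  have hy0 : P.valuation K y ≠ 0 := by
    intro h
    rw [h] at hy
    simp at hy
  rw [← WithZero.exp_log hy0, ← WithZero.exp_nsmul, WithZero.exp_inj] at hy
  simp at hy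
  omega

theorem valuation_le_exp_of_lt_one {P : HeightOneSpectrum (𝓞 K)} {z : K}
    (hz : P.valuation K z < 1) : P.valuation K z ≤ WithZero.exp (-1 : ℤ) := by
  rcases eq_or_ne (P.valuation K z) 0 with h | h
  · simp [h]
  · rw [← WithZero.exp_log h] at hz ⊢
    rw [← WithZero.exp_zero, WithZero.exp_lt_exp] at hz
    rw [WithZero.exp_le_exp]
    omega

theorem exists_valuation_sub_lt_one {P : HeightOneSpectrum (𝓞 K)} {z : K}
    (hz : P.valuation K z ≤ 1) : ∃ x : 𝓞 K, P.valuation K (z - x) < 1 := by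
  obtain ⟨x, hx⟩ := P.exists_valuation_sub_lt_of_integer hz 1
  exact ⟨x, by rw [Valuation.map_sub_swap]; simpa using hx⟩

theorem valuation_pow_three_sub_lt_one {P : HeightOneSpectrum (𝓞 K)} {z w : K}
    (hz : P.valuation K z ≤ 1) (hzw : P.valuation K (z - w) < 1) :
    P.valuation K (z ^ 3 - w ^ 3) < 1 := by
  have hw : P.valuation K w ≤ 1 := by
    have := Valuation.map_sub_le _ hz hzw.le
    simpa using this
  have h : z ^ 3 - w ^ 3 = (z - w) * (z * z + z * w + w * w) := by ring
  rw [h, map_mul]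
  refine mul_lt_one_of_lt_of_le hzw ?_
  refine Valuation.map_add_le _ (Valuation.map_add_le _ ?_ ?_) ?_ <;> rw [map_mul] <;>
    exact mul_le_one' ‹_› ‹_›

/-- Local cubic residues at finitely many primes can be glued. -/
theorem exists_forall_valuation_sub_pow_three_lt_one {p : ℕ} (hp : p ≠ 0) (α : K)
    (h : ∀ P : HeightOneSpectrum (𝓞 K), (p : 𝓞 K) ∈ P.asIdeal →
      ∃ x : 𝓞 K, P.valuation K (α - (x : K) ^ 3) < 1) :
    ∃ x : 𝓞 K, ∀ P : HeightOneSpectrum (𝓞 K), (p : 𝓞 K) ∈ P.asIdeal →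
      P.valuation K (α - (x : K) ^ 3) < 1 := by
  have hp0 : Ideal.span {(p : 𝓞 K)} ≠ 0 := by simpa using hp
  have hfin := Ideal.finite_factors hp0
  have hmem (P : HeightOneSpectrum (𝓞 K)) : P ∈ hfin.toFinset ↔ (p : 𝓞 K) ∈ P.asIdeal := by
    simp [Ideal.dvd_span_singleton]
  choose! f hf using h
  obtain ⟨x, hx⟩ := IsDedekindDomain.exists_forall_sub_mem_ideal (s := hfin.toFinset)
    (fun P => P.asIdeal) (fun _ => 1) (fun P _ => P.prime)
    (fun P _ Q _ hPQ h => hPQ (HeightOneSpectrum.ext h)) (fun P => f P)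
  refine ⟨x, fun P hP => ?_⟩
  have hx1 := hx P ((hmem P).2 hP)
  rw [pow_one] at hx1
  have h1 : P.valuation K ((f P : K) - x) < 1 := by
    rw [Valuation.map_sub_swap, ← map_sub]
    exact (P.valuation_lt_one_iff_mem _).2 hx1
  have h2 := valuation_pow_three_sub_lt_one (P.valuation_le_one (f P)) h1
  have h3 : α - (x : K) ^ 3 = (α - (f P : K) ^ 3) + ((f P : K) ^ 3 - (x : K) ^ 3) := by ring
  rw [h3]
  exact Valuation.map_add_lt _ (hf P hP) h2

/-- Elements of `𝓞 K` represent every residue class, so `α` is not a cube in the residue field and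
`cubicNormForm_eq_zero` applies there. -/
theorem cubicNormForm_valuation_lt_one {P : HeightOneSpectrum (𝓞 K)} {α a b c : K}
    (hα : P.valuation K α ≤ 1) (hres : ∀ x : 𝓞 K, ¬ P.valuation K (α - (x : K) ^ 3) < 1)
    (ha : P.valuation K a ≤ 1) (hb : P.valuation K b ≤ 1) (hc : P.valuation K c ≤ 1)
    (hN : P.valuation K (cubicNormForm α a b c) < 1) :
    P.valuation K a < 1 ∧ P.valuation K b < 1 ∧ P.valuation K c < 1 := by
  let O := (P.valuation K).valuationSubring
  let r := IsLocalRing.residue O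
  have hr (z : O) : r z = 0 ↔ P.valuation K z < 1 := by
    rw [IsLocalRing.residue_eq_zero_iff]
    exact (Valuation.mem_maximalIdeal_iff ..)
  let α' : O := ⟨α, hα⟩
  let a' : O := ⟨a, ha⟩
  let b' : O := ⟨b, hb⟩
  let c' : O := ⟨c, hc⟩
  have hcube : ∀ z, z ^ 3 ≠ r α' := by
    intro z hz
    obtain ⟨w, rfl⟩ := IsLocalRing.residue_surjective z
    have h1 : r (α' - w ^ 3) = 0 := by rw [map_sub, map_pow, hz, sub_self]
    rw [hr] at h1
    obtain ⟨x, hx⟩ := exists_valuation_sub_lt_one (P := P) w.2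
    refine hres x ?_
    have h2 := valuation_pow_three_sub_lt_one (P := P) w.2 hx
    have h3 : α - (x : K) ^ 3 = (α - (w : K) ^ 3) + ((w : K) ^ 3 - (x : K) ^ 3) := by ring
    rw [h3]
    exact Valuation.map_add_lt _ h1 h2
  have h0 : cubicNormForm (r α') (r a') (r b') (r c') = 0 := by
    have : r (cubicNormForm α' a' b' c') = 0 := (hr _).2 hN
    simpa [cubicNormForm, map_ofNat] using this
  obtain ⟨h1, h2, h3⟩ := cubicNormForm_eq_zero hcube h0
  exact ⟨(hr _).1 h1, (hr _).1 h2, (hr _).1 h3⟩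

/-- If the valuation of a value of the norm form is not that of a cube, `α` is a local cubic
residue. -/
theorem exists_valuation_sub_pow_three_lt_one {P : HeightOneSpectrum (𝓞 K)} {α a b c : K}
    (hα : P.valuation K α ≤ 1) (hN : ¬ IsCubeVal P (cubicNormForm α a b c)) :
    ∃ x : 𝓞 K, P.valuation K (α - (x : K) ^ 3) < 1 := by
  by_contra! hres
  -- Dividing by a coordinate `m` of largest valuation changes the cubic form by the cube `m ^ 3`
  -- and leaves one coordinate equal to 1, which cannot reduce to zero.
  obtain ⟨m, hma, hmb, hmc, hm⟩ : ∃ m, P.valuation K a ≤ P.valuation K m ∧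
      P.valuation K b ≤ P.valuation K m ∧ P.valuation K c ≤ P.valuation K m ∧
      (m = a ∨ m = b ∨ m = c) := by
    rcases le_total (P.valuation K a) (P.valuation K b) with h1 | h1 <;>
    rcases le_total (P.valuation K b) (P.valuation K c) with h2 | h2 <;>
    rcases le_total (P.valuation K a) (P.valuation K c) with h3 | h3
    · exact ⟨c, h3, h2, le_rfl, by simp⟩
    · exact ⟨c, h1.trans h2, h2, le_rfl, by simp⟩
    · exact ⟨b, h1, le_rfl, h2, by simp⟩
    · exact ⟨b, h1, le_rfl, h2, by simp⟩
    · exact ⟨c, h3, h2, le_rfl, by simp⟩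
    · exact ⟨a, le_rfl, h1, h3, by simp⟩
    · exact ⟨a, le_rfl, h1, h2.trans h1, by simp⟩
    · exact ⟨a, le_rfl, h1, h3, by simp⟩
  have hm0 : m ≠ 0 := by
    rintro rfl
    simp only [map_zero, le_zero_iff, map_eq_zero] at hma hmb hmc
    exact hN ⟨0, by simp [cubicNormForm, hma, hmb, hmc]⟩
  have hvm : 0 < P.valuation K m := zero_lt_iff.2 ((Valuation.ne_zero_iff _).2 hm0)
  have hscale : cubicNormForm α a b c = cubicNormForm α (a / m) (b / m) (c / m) * m ^ 3 := by
    unfold cubicNormForm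
    field_simp
  have hdiv {z : K} (hz : P.valuation K z ≤ P.valuation K m) : P.valuation K (z / m) ≤ 1 := by
    rw [map_div₀]
    exact (div_le_one₀ hvm).2 hz
  have hle : P.valuation K (cubicNormForm α (a / m) (b / m) (c / m)) ≤ 1 := by
    let O := (P.valuation K).valuationSubring
    exact (cubicNormForm (⟨α, hα⟩ : O) ⟨_, hdiv hma⟩ ⟨_, hdiv hmb⟩ ⟨_, hdiv hmc⟩).2
  have hlt := lt_of_le_of_ne hle fun h => hN
    (hscale ▸ (isCubeVal_of_eq_one h).mul (isCubeVal_pow_three P m))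
  obtain ⟨h1, h2, h3⟩ := cubicNormForm_valuation_lt_one hα (fun x => not_lt.2 (hres x))
    (hdiv hma) (hdiv hmb) (hdiv hmc) hlt
  rcases hm with rfl | rfl | rfl
  · simp [hm0] at h1
  · simp [hm0] at h2
  · simp [hm0] at h3

/-- If `α` is a local cubic residue, some `α - x ^ 3` has valuation not that of a cube. -/
theorem exists_not_isCubeVal_sub_pow_three {P : HeightOneSpectrum (𝓞 K)} {α : K}
    (h3 : (3 : 𝓞 K) ∉ P.asIdeal) (hα : P.valuation K α = 1) {x : 𝓞 K}
    (hx : P.valuation K (α - (x : K) ^ 3) < 1) :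
    ∃ y : K, ¬ IsCubeVal P (α - y ^ 3) := by
  by_cases hC : IsCubeVal P (α - (x : K) ^ 3)
  swap
  · exact ⟨x, hC⟩
  obtain ⟨w, hw⟩ := hC
  obtain ⟨π, hπ⟩ := P.valuation_exists_uniformizer K
  set e := WithZero.exp (-1 : ℤ) with he
  have he1 : e < 1 := by rw [he, ← WithZero.exp_zero, WithZero.exp_lt_exp]; norm_num
  have he0 : 0 < e := WithZero.exp_pos
  have hee : e * e < e := mul_lt_of_lt_one_right he0 he1
  have hx1 : P.valuation K (x : K) = 1 := by
    have h : P.valuation K ((x : K) ^ 3) = 1 := by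
      have h := Valuation.map_sub_eq_of_lt_right (P.valuation K) (x := α - (x : K) ^ 3) (y := α) (by rwa [hα])
      rw [← hα, ← h, ← Valuation.map_neg]
      congr 1
      ring
    rw [map_pow] at h
    exact (pow_eq_one_iff.1 h).resolve_right (by norm_num)
  have hw1 : P.valuation K w ≤ e := valuation_le_exp_of_lt_one (by
    rw [hw] at hx
    exact (pow_lt_one_iff (by norm_num)).1 hx)
  have h3v : P.valuation K (3 : K) = 1 := by
    have := (P.valuation_eq_one_iff_notMem (K := K)).2 h3
    rwa [map_ofNat] at this
  -- `α - x ^ 3` is zero or of positive order divisible by 3, so it is negligible here: `3 x ^ 2 π`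
  -- is the leading term of the difference and has order exactly 1, because `P ∤ 3`.
  refine ⟨x + π, not_isCubeVal_of_eq_exp ?_⟩
  have hmain : P.valuation K (3 * (x : K) ^ 2 * π) = e := by simp [hx1, h3v, hπ]
  have hrest : P.valuation K ((α - (x : K) ^ 3) - (3 * x + π) * π ^ 2) < e := by
    refine lt_of_le_of_lt (Valuation.map_sub_le _ ?_ ?_) hee
    · rw [hw, pow_succ, sq]
      calc _ ≤ e * e * 1 := by gcongr; exact hw1.trans he1.le
        _ = e * e := mul_one _
    · rw [map_mul, map_pow, hπ, sq]
      refine mul_le_of_le_one_left' (Valuation.map_add_le _ ?_ ?_)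
      · simp [hx1, h3v]
      · rw [hπ]; exact he1.le
  have hsplit : α - ((x : K) + π) ^ 3 =
      ((α - (x : K) ^ 3) - (3 * x + π) * π ^ 2) - 3 * (x : K) ^ 2 * π := by ring
  rw [hsplit, Valuation.map_sub_eq_of_lt_right _ (by rwa [hmain]), hmain]

theorem three_notMem_of_natCast_mem {p : ℕ} (hp : p.Prime) (hp3 : p ≠ 3)
    {P : HeightOneSpectrum (𝓞 K)} (hP : (p : 𝓞 K) ∈ P.asIdeal) : (3 : 𝓞 K) ∉ P.asIdeal := by
  intro h3
  obtain ⟨a, b, hab⟩ := Nat.isCoprime_iff_coprime.2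
    ((Nat.coprime_primes hp Nat.prime_three).2 hp3)
  refine P.isPrime.ne_top ((Ideal.eq_top_iff_one _).2 ?_)
  have h1 : (1 : 𝓞 K) = a * p + b * 3 := by exact_mod_cast congrArg (Int.cast (R := 𝓞 K)) hab.symm
  rw [h1]
  exact add_mem (Ideal.mul_mem_left _ _ hP) (Ideal.mul_mem_left _ _ h3)

end Valuation

/-! ### Prime elements as norms up to units. -/

section NormUpToUnit

open NumberField IsDedekindDomain

theorem Algebra.norm_div {K L : Type*} [Field K] [Field L] [Algebra K L] [FiniteDimensional K L]
    (x y : L) : Algebra.norm K (x / y) = Algebra.norm K x / Algebra.norm K y := by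
  rcases eq_or_ne y 0 with rfl | hy
  · simp [Algebra.norm_zero]
  · rw [eq_div_iff (Algebra.norm_ne_zero_iff.2 hy), ← map_mul, div_mul_cancel₀ _ hy]

/-- Some unit multiple of `β` is a norm from `L`. -/
def IsNormUpToUnit {K : Type*} [Field K] (L : Type*) [Field L] [Algebra K L] (β : K) : Prop :=
  ∃ (u : (𝓞 K)ˣ) (z : L), Algebra.norm K z = ((u : 𝓞 K) : K) * β

theorem IsNormUpToUnit.mul {K L : Type*} [Field K] [Field L] [Algebra K L] {β γ : K}
    (hβ : IsNormUpToUnit L β) (hγ : IsNormUpToUnit L γ) :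
    IsNormUpToUnit L (β * γ) := by
  obtain ⟨u, z, hz⟩ := hβ
  obtain ⟨v, w, hw⟩ := hγ
  refine ⟨u * v, z * w, ?_⟩
  rw [map_mul, hz, hw]
  push_cast
  ring

theorem isNormUpToUnit_of_prime_factors {K L : Type*} [Field K] [Field L] [Algebra K L]
    [IsPrincipalIdealRing (𝓞 K)] {n : 𝓞 K} (hn : n ≠ 0)
    (h : ∀ π : 𝓞 K, Prime π → π ∣ n → IsNormUpToUnit L (π : K)) :
    IsNormUpToUnit L (n : K) := by
  induction n using UniqueFactorizationMonoid.induction_on_prime with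
  | h₁ => exact absurd rfl hn
  | h₂ x hx =>
    obtain ⟨u, rfl⟩ := hx
    refine ⟨u⁻¹, 1, ?_⟩
    rw [map_one, ← map_mul, Units.inv_mul, map_one]
  | h₃ a π ha hπ ih =>
    push_cast
    exact (h π hπ (dvd_mul_right _ _)).mul
      (ih ha fun ρ hρ hρa => h ρ hρ (hρa.mul_left _))

variable {K L : Type*} [Field K] [NumberField K] [Field L] [NumberField L] [Algebra K L]

/-- The norm of a prime element is associated to a power of a prime element. -/
theorem exists_associated_intNorm_prime [IsPrincipalIdealRing (𝓞 K)] {γ : 𝓞 L} (hγ : Prime γ) :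
    ∃ (π : 𝓞 K) (k : ℕ), Prime π ∧ Associated (Algebra.intNorm (𝓞 K) (𝓞 L) γ) (π ^ k) := by
  have hnorm (x : 𝓞 L) := Algebra.algebraMap_intNorm (A := 𝓞 K) (K := K) (L := L) x
  have hN0 : Algebra.intNorm (𝓞 K) (𝓞 L) γ ≠ 0 := by
    intro h
    have h1 := hnorm γ
    rw [h, map_zero, eq_comm, Algebra.norm_eq_zero_iff] at h1
    exact hγ.ne_zero (by simpa using h1)
  have hdvd : γ ∣ algebraMap (𝓞 K) (𝓞 L) (Algebra.intNorm (𝓞 K) (𝓞 L) γ) :=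
    Algebra.dvd_algebraMap_intNorm_self _ _ γ
  -- `γ` divides its own norm, hence some prime factor `π` of it in `𝓞 K`. Taking norms, the norm of
  -- `γ` divides `π ^ [L : K]`.
  obtain ⟨s, hs, u, hu⟩ := UniqueFactorizationMonoid.exists_prime_factors _ hN0
  rw [← hu, map_mul] at hdvd
  have hdvd' : γ ∣ algebraMap (𝓞 K) (𝓞 L) s.prod :=
    (hγ.dvd_or_dvd hdvd).resolve_right
      fun h => hγ.not_isUnit (isUnit_of_dvd_unit h (u.isUnit.map _))
  rw [map_multiset_prod] at hdvd'
  obtain ⟨π, hπ, hγπ⟩ := hγ.exists_mem_multiset_map_dvd hdvd'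
  have h := map_dvd (Algebra.intNorm (𝓞 K) (𝓞 L)) hγπ
  have hpow : Algebra.intNorm (𝓞 K) (𝓞 L) (algebraMap (𝓞 K) (𝓞 L) π) =
      π ^ Module.finrank K L := by
    apply FaithfulSMul.algebraMap_injective (𝓞 K) K
    rw [hnorm, ← IsScalarTower.algebraMap_apply, IsScalarTower.algebraMap_apply (𝓞 K) K L,
      Algebra.norm_algebraMap, map_pow]
  rw [hpow] at h
  obtain ⟨k, -, hk⟩ := (dvd_prime_pow (hs π hπ) _).1 h
  exact ⟨π, k, hs π hπ, hk⟩

/-- Cube valuations are closed under products and quotients, and every element of `L` is a quotient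
of products of units and primes of `𝓞 L`; zero is covered because its valuation counts as a cube. -/
theorem isCubeVal_norm [IsPrincipalIdealRing (𝓞 L)] {P : HeightOneSpectrum (𝓞 K)}
    (h : ∀ γ : 𝓞 L, Prime γ → IsCubeVal P (Algebra.norm K (γ : L))) (z : L) :
    IsCubeVal P (Algebra.norm K z) := by
  have integral (y : 𝓞 L) : IsCubeVal P (Algebra.norm K (y : L)) := by
    induction y using UniqueFactorizationMonoid.induction_on_prime with
    | h₁ => exact ⟨0, by simp [Algebra.norm_zero]⟩
    | h₂ x hx =>
      refine isCubeVal_of_eq_one ?_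
      have := valuation_unit P (hx.map (Algebra.intNorm (𝓞 K) (𝓞 L))).unit
      rw [IsUnit.unit_spec] at this
      exact (congrArg _ (Algebra.algebraMap_intNorm (A := 𝓞 K) (L := L) x)).symm.trans this
    | h₃ a γ _ hγ ih =>
      push_cast
      rw [map_mul]
      exact (h γ hγ).mul ih
  obtain ⟨x, y, -, rfl⟩ := IsFractionRing.div_surjective (A := 𝓞 L) z
  rw [Algebra.norm_div]
  exact (integral x).div (integral y)

theorem isNormUpToUnit_of_not_isCubeVal [IsPrincipalIdealRing (𝓞 K)] [IsPrincipalIdealRing (𝓞 L)]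
    (hKL : Module.finrank K L = 3) {P : HeightOneSpectrum (𝓞 K)} {π : 𝓞 K} (hπ : Prime π)
    (hπP : π ∈ P.asIdeal) {z : L} (hz : ¬ IsCubeVal P (Algebra.norm K z)) :
    IsNormUpToUnit L (π : K) := by
  obtain ⟨γ, hγ, hγP⟩ : ∃ γ : 𝓞 L, Prime γ ∧ ¬ IsCubeVal P (Algebra.norm K (γ : L)) := by
    by_contra! h
    exact hz (isCubeVal_norm h z)
  obtain ⟨ρ, k, hρ, hk⟩ := exists_associated_intNorm_prime (K := K) hγ
  have hγN := Algebra.algebraMap_intNorm (A := 𝓞 K) (K := K) (L := L) γ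
  obtain ⟨u, hu⟩ := hk.symm
  rw [← hu] at hγN
  have hρP : ρ ∈ P.asIdeal := by
    by_contra hρP
    refine hγP (isCubeVal_of_eq_one ?_)
    rw [← hγN, map_mul, map_mul, map_pow, map_pow, valuation_unit,
      P.valuation_eq_one_iff_notMem.2 hρP, one_pow, one_mul]
  have hspan {τ : 𝓞 K} (hτ : Prime τ) (hτP : τ ∈ P.asIdeal) : Ideal.span {τ} = P.asIdeal :=
    (((Ideal.span_singleton_prime hτ.ne_zero).2 hτ).isMaximal
      (by simpa using hτ.ne_zero)).eq_of_le P.isPrime.ne_top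
      ((Ideal.span_singleton_le_iff_mem _).2 hτP)
  obtain ⟨w, rfl⟩ : Associated π ρ := by
    rw [← Ideal.span_singleton_eq_span_singleton, hspan hπ hπP, hspan hρ hρP]
  have hπ0 : (π : K) ≠ 0 := by simpa using hπ.ne_zero
  have hnorm (x : K) : Algebra.norm K (algebraMap K L x) = x ^ 3 := by
    rw [Algebra.norm_algebraMap, hKL]
  have hγN' : Algebra.norm K (γ : L) = (π : K) ^ k * ((w ^ k * u : (𝓞 K)ˣ) : 𝓞 K) := by
    rw [← hγN]
    push_cast
    ring
  generalize w ^ k * u = e at hγN'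
  have he0 : ((e : 𝓞 K) : K) ≠ 0 := by simp
  -- The exponent `k` matters only modulo 3, since `π ^ 3` is the norm of `π`: residue 0 contradicts
  -- the choice of `γ`, residue 1 uses `γ / π ^ j`, residue 2 uses `π ^ (j + 1) / γ`.
  obtain ⟨j, hj | hj | hj⟩ : ∃ j, k = 3 * j ∨ k = 3 * j + 1 ∨ k = 3 * j + 2 :=
    ⟨k / 3, by omega⟩
  · refine absurd ?_ hγP
    rw [hγN', hj, mul_comm 3 j, pow_mul]
    exact (isCubeVal_pow_three _ _).mul (isCubeVal_of_eq_one (valuation_unit _ _))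
  · refine ⟨e, γ / algebraMap K L ((π : K) ^ j), ?_⟩
    rw [Algebra.norm_div, hnorm, hγN', hj]
    field_simp
    ring
  · refine ⟨e⁻¹, algebraMap K L ((π : K) ^ (j + 1)) / γ, ?_⟩
    rw [Algebra.norm_div, hnorm, hγN', hj]
    have he : (((e⁻¹ : (𝓞 K)ˣ) : 𝓞 K) : K) = ((e : 𝓞 K) : K)⁻¹ := by
      refine eq_inv_of_mul_eq_one_left ?_
      rw [← map_mul, Units.inv_mul, map_one]
    rw [he]
    field_simp
    ring

end NormUpToUnit

/-! ### The field of cube roots of unity and the two implications. -/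

section Eisenstein

open NumberField IsDedekindDomain

variable {K : Type*} [Field K] [NumberField K] [IsCyclotomicExtension {3} ℚ K]

/-- Only primes dividing 3 ramify in the third cyclotomic field, so `p ∉ P ^ 2`. -/
theorem valuation_natCast_prime {p : ℕ} (hp : p.Prime) (hp3 : p ≠ 3)
    {P : HeightOneSpectrum (𝓞 K)} (hP : (p : 𝓞 K) ∈ P.asIdeal) :
    P.valuation K (p : K) = WithZero.exp (-1 : ℤ) := by
  have : Fact p.Prime := ⟨hp⟩
  have hp0 : (p : 𝓞 K) ≠ 0 := by exact_mod_cast hp.ne_zero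
  have hover : P.asIdeal.LiesOver (Ideal.span {(p : ℤ)}) :=
    (Ideal.liesOver_span_iff P.isPrime.ne_top (Nat.prime_iff_prime_int.1 hp)).2 (by simpa using hP)
  have hram := IsCyclotomicExtension.Rat.ramificationIdx_eq_of_not_dvd p K P.asIdeal (m := 3)
    fun h => hp3 ((Nat.prime_dvd_prime_iff_eq hp Nat.prime_three).1 h)
  rw [← Ideal.ramificationIdx'_eq_ramificationIdx (Ideal.span {(p : ℤ)}) P.asIdeal
    (by simpa using hp.ne_zero)] at hram
  have hmap : (Ideal.span {(p : ℤ)}).map (algebraMap ℤ (𝓞 K)) = Ideal.span {(p : 𝓞 K)} := by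
    simp [Ideal.map_span]
  have hle : (Ideal.span {(p : ℤ)}).map (algebraMap ℤ (𝓞 K)) ≤ P.asIdeal := by
    rwa [hmap, Ideal.span_singleton_le_iff_mem]
  have hsq : (p : 𝓞 K) ∉ P.asIdeal ^ 2 := fun h =>
    (Ideal.ramificationIdx'_ne_one_iff hle).2
      (by rwa [hmap, Ideal.span_singleton_le_iff_mem]) hram
  have hcast : P.valuation K (p : K) = P.intValuation (p : 𝓞 K) := by
    rw [← HeightOneSpectrum.valuation_of_algebraMap (K := K)]
    push_cast
    rfl
  refine le_antisymm (valuation_le_exp_of_lt_one ?_) ?_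
  · rw [hcast]
    exact (P.intValuation_lt_one_iff_mem _).2 hP
  · rw [hcast]
    by_contra! h
    refine hsq ((P.intValuation_le_pow_iff_mem _ 2).1 ?_)
    have h0 := P.intValuation_ne_zero _ hp0
    rw [← WithZero.exp_log h0] at h ⊢
    rw [WithZero.exp_lt_exp] at h
    rw [WithZero.exp_le_exp]
    push_cast
    omega

theorem mem_adjoin_iff_isIntegral {ε : K} (hε : IsPrimitiveRoot ε 3) (z : K) :
    z ∈ Algebra.adjoin ℤ {ε} ↔ IsIntegral ℤ z := by
  have := Fact.mk Nat.prime_three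
  have := IsCyclotomicExtension.Rat.isIntegralClosure_adjoin_singleton_of_prime hε
  rw [IsIntegralClosure.isIntegral_iff (A := Algebra.adjoin ℤ {ε})]
  exact ⟨fun h => ⟨⟨z, h⟩, rfl⟩, fun ⟨w, hw⟩ => hw ▸ w.2⟩

/-- The ring of integers of `K` is `ℤ[ε]`. -/
noncomputable def ringOfIntegersEquivAdjoin {ε : K} (hε : IsPrimitiveRoot ε 3) :
    𝓞 K ≃+* Algebra.adjoin ℤ {ε} where
  toFun z := ⟨z, (mem_adjoin_iff_isIntegral hε _).2 z.2⟩
  invFun z := ⟨z, (mem_adjoin_iff_isIntegral hε _).1 z.2⟩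
  left_inv _ := rfl
  right_inv _ := rfl
  map_mul' _ _ := rfl
  map_add' _ _ := rfl

theorem isCubicResidueMod_of_local {p : ℕ} (hp : p.Prime) (hp3 : p ≠ 3) (α : K)
    (h : ∀ P : HeightOneSpectrum (𝓞 K), (p : 𝓞 K) ∈ P.asIdeal →
      ∃ x : 𝓞 K, P.valuation K (α - (x : K) ^ 3) < 1) : IsCubicResidueMod α p := by
  obtain ⟨x, hx⟩ := exists_forall_valuation_sub_pow_three_lt_one hp.ne_zero α h
  refine ⟨x, fun P hP => ?_⟩
  rw [valuation_natCast_prime hp hp3 hP]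
  exact valuation_le_exp_of_lt_one (hx P hP)

/-- This direction works for every unit `u`: units do not affect the order of `u p` at `P`, which is
1 and hence not a multiple of 3. -/
theorem isCubicResidueMod_of_isSplitAlgebra {ε : K} (hε : IsPrimitiveRoot ε 3) {α : K} {p : ℕ}
    (hp : p.Prime) (hp3 : p ≠ 3) (hαp : HasNoCubeAt α p) (u : (𝓞 K)ˣ)
    (h : IsSplitAlgebra K (SymbolAlgebra 3 α (((u : 𝓞 K) : K) * (p : K)) ε)) :
    IsCubicResidueMod α p := by
  refine isCubicResidueMod_of_local hp hp3 α fun P hP => ?_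
  by_cases hcube : ∃ z : K, z ^ 3 = α
  · obtain ⟨z, rfl⟩ := hcube
    have hz1 : P.valuation K z ≤ 1 := by
      have := (hαp P hP).1
      rw [map_pow] at this
      exact (pow_le_one_iff (by norm_num)).1 this
    obtain ⟨x, hx⟩ := exists_valuation_sub_lt_one hz1
    exact ⟨x, valuation_pow_three_sub_lt_one hz1 hx⟩
  · obtain ⟨a, b, c, hN⟩ := SymbolAlgebra.exists_cubicNormForm_of_isSplitAlgebra hε
      (not_exists.1 hcube) h
    refine exists_valuation_sub_pow_three_lt_one (hαp P hP).1 (a := a) (b := b) (c := c) ?_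
    rw [hN]
    refine not_isCubeVal_of_eq_exp ?_
    rw [map_mul, valuation_unit, one_mul, valuation_natCast_prime hp hp3 hP]

theorem exists_isSplitAlgebra_of_isCubicResidueMod {ε : K} (hε : IsPrimitiveRoot ε 3) {α : K}
    (hα : α ≠ 0) {p : ℕ} (hp : p.Prime) (hp3 : p ≠ 3) (hαp : HasNoCubeAt α p)
    {L : Type*} [Field L] [NumberField L] [Algebra K L] {θ : L}
    (hθ : θ ^ 3 = algebraMap K L α) (hL : IntermediateField.adjoin K {θ} = ⊤)
    [IsPrincipalIdealRing (𝓞 L)] (hres : IsCubicResidueMod α p) :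
    ∃ u : (𝓞 K)ˣ, IsSplitAlgebra K (SymbolAlgebra 3 α (((u : 𝓞 K) : K) * (p : K)) ε) := by
  have hp0 : (p : K) ≠ 0 := by exact_mod_cast hp.ne_zero
  by_cases hcube : ∃ z : K, z ^ 3 = α
  · obtain ⟨z, hz⟩ := hcube
    exact ⟨1, SymbolAlgebra.isSplitAlgebra_of_pow_three hε hz hα (by simpa using hp0)⟩
  rw [not_exists] at hcube
  have : IsPrincipalIdealRing (𝓞 K) := IsCyclotomicExtension.Rat.three_pid K
  have hp0' : (p : 𝓞 K) ≠ 0 := by exact_mod_cast hp.ne_zero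
  obtain ⟨x, hx⟩ := hres
  obtain ⟨u, z, hz⟩ : IsNormUpToUnit L ((p : 𝓞 K) : K) := by
    refine isNormUpToUnit_of_prime_factors hp0' fun π hπ hπp => ?_
    let P : HeightOneSpectrum (𝓞 K) := ⟨Ideal.span {π},
      (Ideal.span_singleton_prime hπ.ne_zero).2 hπ, by simpa using hπ.ne_zero⟩
    have hP : (p : 𝓞 K) ∈ P.asIdeal := Ideal.mem_span_singleton.2 hπp
    -- If `α` is a unit at `P`, take `w = θ - y`, of norm `α - y ^ 3`; otherwise `w = θ`, of norm
    -- `α`, whose order is not a multiple of 3 by `HasNoCubeAt`.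
    obtain ⟨w, hw⟩ : ∃ w : L, ¬ IsCubeVal P (Algebra.norm K w) := by
      by_cases hα1 : P.valuation K α = 1
      · have hx1 : P.valuation K (α - (x : K) ^ 3) < 1 := by
          refine (hx P hP).trans_lt ?_
          rw [valuation_natCast_prime hp hp3 hP, ← WithZero.exp_zero, WithZero.exp_lt_exp]
          norm_num
        obtain ⟨y, hy⟩ := exists_not_isCubeVal_sub_pow_three
          (three_notMem_of_natCast_mem hp hp3 hP) hα1 hx1
        refine ⟨(-y) • 1 + (1 : K) • θ + (0 : K) • θ ^ 2, ?_⟩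
        rw [norm_of_pow_three hcube hθ hL]
        convert hy using 1
        simp only [cubicNormForm]
        ring_nf
      · refine ⟨(0 : K) • 1 + (1 : K) • θ + (0 : K) • θ ^ 2, ?_⟩
        rw [norm_of_pow_three hcube hθ hL]
        have : cubicNormForm α 0 1 0 = α := by simp [cubicNormForm]
        rw [this]
        exact fun h => hα1 ((hαp P hP).2 h)
    exact isNormUpToUnit_of_not_isCubeVal (finrank_of_pow_three hcube hθ hL) hπ
      (Ideal.mem_span_singleton_self π) hw
  obtain ⟨a, b, c, hN⟩ := exists_norm_eq_cubicNormForm hcube hθ hL z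
  rw [hz] at hN
  push_cast at hN
  refine ⟨u, SymbolAlgebra.isSplitAlgebra_of_cubicNormForm hε hα (mul_ne_zero ?_ hp0) hN.symm⟩
  simp

end Eisenstein

theorem proposition3p9
    {K : Type*} [Field K] [NumberField K] [IsCyclotomicExtension {3} ℚ K]
    (ε : K) (hε : IsPrimitiveRoot ε 3)
    (α : K) (hα : α ≠ 0)
    (p : ℕ) (hp : p.Prime) (hp3 : p ≠ 3)
    (hαp : HasNoCubeAt α p)
    {L : Type*} [Field L] [NumberField L] [Algebra K L]
    (θ : L) (hθ : θ ^ 3 = algebraMap K L α) (hL : IntermediateField.adjoin K {θ} = ⊤)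
    (hcl : NumberField.classNumber L = 1) :
    (∃ u : (Algebra.adjoin ℤ {ε})ˣ,
      IsSplitAlgebra K
        (SymbolAlgebra 3 α (((u : Algebra.adjoin ℤ {ε}) : K) * (p : K)) ε)) ↔
      IsCubicResidueMod α p := by
  have : IsPrincipalIdealRing (NumberField.RingOfIntegers L) :=
    NumberField.classNumber_eq_one_iff.1 hcl
  let e := Units.mapEquiv (ringOfIntegersEquivAdjoin hε).toMulEquiv
  constructor
  · rintro ⟨u, hu⟩
    exact isCubicResidueMod_of_isSplitAlgebra hε hp hp3 hαp (e.symm u) hu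
  · intro hres
    obtain ⟨u, hu⟩ := exists_isSplitAlgebra_of_isCubicResidueMod hε hα hp hp3 hαp hθ hL hres
    exact ⟨e u, hu⟩
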